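/- **Conventions.** For $\Lambda\subset\mathbb R$ and a measurable set $S\subset\mathbb R$ of finite measure, $E(\Lambda)=\{e^{2\pi i\lambda(\cdot)}:\lambda\in\Lambda\}$, regarded as a family in $L^2(S)$ indexed by $\Lambda$. A family $(f_i)_{i\in I}$ in a complex Hilbert space $\mathcal H$ is a *Riesz basis* for $\mathcal H$ if its linear span is dense in $\mathcal H$ and there are constants $0<A\le B<\infty$ such that for every $c=(c_i)\in\ell^2(I)$ the series $\sum_i c_if_i$ converges unconditionally and $A\|c\|_{\ell^2}^2\le\big\|\sum_{i} c_if_i\big\|^2\le B\|c\|_{\ell^2}^2$. (In particular, the empty family is a Riesz basis of $\{0\}$.) For $X\subset\mathbb R$ and $a\in\mathbb R$, $X+a=\{x+a:x\in X\}$. **Proposition 3.3.** Let $M,N$ be positive integers with $M\le N$, let $S_M\subset\cdots\subset S_1\subset[0,\tfrac1N)$ be measurable sets, and let $\Lambda_1,\dots,\Lambda_M\subset N\mathbb Z$ be such that for each $m=1,\dots,M$ the system $E(\Lambda_m)$ is a Riesz basis for $L^2(S_m)$. (a) For every permutation $(\ell_n)_{n=1}^N$ of $\{1,\dots,N\}$,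 the system $E\big(\bigcup_{m=1}^M(\Lambda_m+m)\big)$ is a Riesz basis for $L^2\big(\bigcup_{m=1}^M(S_m+\tfrac{\ell_m-1}{N})\big)$. (b) If $N$ is prime, then for all permutations $(k_n)_{n=1}^N$ and $(\ell_n)_{n=1}^N$ of $\{1,\dots,N\}$, the system $E\big(\bigcup_{m=1}^M(\Lambda_m+k_m)\big)$ is a Riesz basis for $L^2\big(\bigcup_{m=1}^M(S_m+\tfrac{\ell_m-1}{N})\big)$, and moreover, for every subset $J\subseteq\{1,\dots,M\}$, the system $E\big(\bigcup_{m\in J}(\Lambda_m+k_m)\big)$ is a Riesz basis for $L^2\big(\bigcup_{m\in J}(S_m+\tfrac{\ell_m-1}{N})\big)$. -/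

import Mathlib

open MeasureTheory

/-- A family `f` in a complex Hilbert space is a Riesz sequence if there are constants
`0 < A ≤ B < ∞` such that, for every square-summable family of coefficients `c`, the series
`∑ c i • f i` converges and `A ‖c‖² ≤ ‖∑ c i • f i‖² ≤ B ‖c‖²`. -/
def IsRieszSequence {ι H : Type*} [NormedAddCommGroup H] [InnerProductSpace ℂ H]
    (f : ι → H) : Prop :=
  ∃ A B : ℝ, 0 < A ∧ A ≤ B ∧ ∀ c : lp (fun _ : ι => ℂ) 2,
    Summable (fun i => c i • f i) ∧
    A * ‖c‖ ^ 2 ≤ ‖∑' i, c i • f i‖ ^ 2 ∧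
    ‖∑' i, c i • f i‖ ^ 2 ≤ B * ‖c‖ ^ 2

/-- A family is complete if its linear span is dense. -/
def IsCompleteFamily {ι H : Type*} [NormedAddCommGroup H] [InnerProductSpace ℂ H]
    (f : ι → H) : Prop :=
  Dense (Submodule.span ℂ (Set.range f) : Set H)

/-- A Riesz basis is a complete Riesz sequence. -/
def IsRieszBasis {ι H : Type*} [NormedAddCommGroup H] [InnerProductSpace ℂ H]
    (f : ι → H) : Prop :=
  IsCompleteFamily f ∧ IsRieszSequence f

/-- The exponential function `t ↦ exp (2 π i l t)` with real frequency `l`. -/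
noncomputable def expFun (l : ℝ) (t : ℝ) : ℂ :=
  Complex.exp (2 * Real.pi * Complex.I * l * t)

/-- The exponential system `E(Λ) = {exp (2 π i l ·) : l ∈ Λ}` consists of functions that are
square-integrable on `S`, and is a Riesz basis for `L²(S)`. -/
def ExpRieszBasis (Λ S : Set ℝ) : Prop :=
  ∃ h : ∀ l : Λ, MemLp (expFun l) 2 (volume.restrict S),
    IsRieszBasis (fun l : Λ => (h l).toLp (expFun l))

/-- The translate `X + a = {x + a : x ∈ X}` of a set of real numbers. -/
def translateSet (X : Set ℝ) (a : ℝ) : Set ℝ :=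
  (fun x => x + a) '' X

/-!
Let `e_x t = exp (2 π i x t)`. A frequency `x ∈ Λ m + k m` is congruent to `k m` modulo `N`, so
translation by `(ℓ j - 1) / N` multiplies `e_x` by the phase `W m j = exp (2 π i k_m (ℓ_j - 1) / N)`,
which depends only on `m` and `j`. A trigonometric polynomial with frequencies in the union splits
as `∑ m, p m` according to residue classes, and on the `j`-th translate it is the combination
`∑ m, W m j * p m` restricted to `S j`. Everything therefore takes place on `[0, 1/N)`, where
exponentials with frequencies in one residue class are orthogonal, and the problem becomes one of
linear algebra for the array `W`. What is needed is that its leading principal minors do not vanish,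
because the sets `S j` decrease: at a point of `S r` outside the next set exactly the first `r`
values are available.

* A Riesz basis is recognized by bounds on finite sums and by triviality of the orthogonal
  complement (`isRieszSequence_of_finset_bounds`, `isCompleteFamily_iff`). The upper bound is
  automatic, since the frequencies are distinct integers and the union of the translates lies in
  `[0, 1)`.
* The lower bound is `LeadingMinorsNeZero.exists_lintegral_le`: on the smallest set the full matrix
  can be inverted, which controls the last `p m` there; by the lower bound for `Λ m` its coefficients
  are controlled, hence its norm on all of `[0, 1/N)`, and it can be subtracted.
* Completeness is `LeadingMinorsNeZero.ae_eq_zero`: if `v` is orthogonal to the whole system, with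
  pieces `v j` supported in `S j`, the combinations `∑ j, conj (W m j) * v j` vanish one after the
  other, each being supported in `S m` once the previous ones vanish.
* For `k m = m` the leading minors are of Vandermonde type. For `N` prime all minors of the Fourier
  matrix are nonzero by Chebotarev's theorem (`det_pow_mul_ne_zero_of_prime`), which is proved by
  reduction modulo the prime `ζ - 1` of the cyclotomic integers. As this holds for all choices of
  rows and columns, any subset of the indices is allowed.
-/

/-! ### Chebotarev's theorem on minors of the Fourier matrix -/

theorem sub_one_pow_dvd_mul_derivative {R : Type*} [CommRing R] {n : ℕ} {P : Polynomial R}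
    (h : (Polynomial.X - 1) ^ (n + 1) ∣ P) :
    (Polynomial.X - 1) ^ n ∣ Polynomial.X * Polynomial.derivative P := by
  obtain ⟨T, rfl⟩ := h
  refine ⟨Polynomial.X * (((n : Polynomial R) + 1) * T
    + (Polynomial.X - 1) * Polynomial.derivative T), ?_⟩
  rw [Polynomial.derivative_mul, Polynomial.derivative_pow_succ]
  simp only [Polynomial.derivative_sub, Polynomial.derivative_X, Polynomial.derivative_one,
    map_add, map_natCast, map_one]
  ring

/-- A polynomial divisible by `(X - 1) ^ n` is annihilated at `1` by all powers below `n` of the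
Euler operator `X d/dX`; on a monomial `X ^ e` this operator acts as multiplication by `e`. -/
theorem sum_mul_pow_eq_zero_of_sub_one_pow_dvd {R ι : Type*} [CommRing R] [Fintype ι]
    (e : ι → ℕ) (n r : ℕ) (hr : r < n) (c : ι → R)
    (h : (Polynomial.X - 1) ^ n ∣ ∑ j, Polynomial.C (c j) * Polynomial.X ^ e j) :
    ∑ j, c j * (e j : R) ^ r = 0 := by
  induction r generalizing n c with
  | zero =>
    have h1 : (Polynomial.X - 1 : Polynomial R) ∣ _ :=
      (dvd_pow_self _ (by omega)).trans h
    obtain ⟨T, hT⟩ := h1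
    have := congrArg (Polynomial.eval 1) hT
    simpa [Polynomial.eval_finsetSum] using this
  | succ r ih =>
    obtain ⟨m, rfl⟩ : ∃ m, n = m + 1 := ⟨n - 1, by omega⟩
    have h1 := sub_one_pow_dvd_mul_derivative h
    have h2 := ih m (by omega) (fun j => c j * e j) (by
      convert h1 using 1
      rw [map_sum, Finset.mul_sum]
      refine Finset.sum_congr rfl fun j _ => ?_
      rw [Polynomial.derivative_C_mul_X_pow]
      rcases Nat.eq_zero_or_pos (e j) with h0 | h0
      · simp [h0]
      · rw [mul_left_comm, ← pow_succ', Nat.sub_add_cancel h0])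
    rw [← h2]
    refine Finset.sum_congr rfl fun j _ => ?_
    ring

/-- If `ζ` has order `p` and `ζ - 1` is prime in a Noetherian domain, the minors of the matrix
`(ζ ^ (a b))` do not vanish. A kernel vector, normalized so that `ζ - 1` does not divide all its
entries, is the coefficient vector of a polynomial with `n` terms and `n` distinct roots, all
congruent to `1`. Modulo `ζ - 1`, where `p = 0`, that polynomial is divisible by `(X - 1) ^ n`,
which forces all its coefficients to vanish. -/
theorem det_pow_mul_ne_zero_of_prime_sub_one {R : Type*} [CommRing R] [IsDomain R]
    [IsNoetherianRing R] {p : ℕ} (hp : p.Prime) {ζ : R} (hζ : IsPrimitiveRoot ζ p)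
    (hprime : Prime (ζ - 1)) {n : ℕ} (k l : Fin n → ℕ)
    (hk : Function.Injective fun i => (k i : ZMod p))
    (hl : Function.Injective fun i => (l i : ZMod p)) :
    (Matrix.of fun i j => ζ ^ (k i * l j)).det ≠ 0 := by
  classical
  intro hdet
  obtain ⟨v, hv0, hv⟩ := Matrix.exists_mulVec_eq_zero_iff.2 hdet
  -- Reduction of a kernel vector modulo `ζ - 1` vanishes.
  have key : ∀ v : Fin n → R, (Matrix.of fun i j => ζ ^ (k i * l j)).mulVec v = 0 →
      ∀ j, (ζ - 1) ∣ v j := by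
    intro v hv
    set I := Ideal.span {ζ - 1} with hI
    have : I.IsPrime := (Ideal.span_singleton_prime hprime.ne_zero).2 hprime
    have hz1 : Ideal.Quotient.mk I ζ = 1 := by
      rw [← sub_eq_zero, ← map_one (Ideal.Quotient.mk I), ← map_sub,
        Ideal.Quotient.eq_zero_iff_mem]
      exact Ideal.mem_span_singleton_self _
    have hp0 : (p : R ⧸ I) = 0 := by
      have := congrArg (Ideal.Quotient.mk I) (hζ.geom_sum_eq_zero hp.one_lt)
      simpa [map_sum, hz1] using this
    have hchar : CharP (R ⧸ I) p := (CharP.charP_iff_prime_eq_zero hp).2 hp0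
    have hl' : Function.Injective fun j => ((l j : ℕ) : R ⧸ I) := by
      intro a b hab
      apply hl
      exact (ZMod.natCast_eq_natCast_iff _ _ _).2 ((CharP.natCast_eq_natCast _ p).1 hab)
    set P : Polynomial R := ∑ j, Polynomial.C (v j) * Polynomial.X ^ l j with hP
    have hroot : ∀ i, P.IsRoot (ζ ^ k i) := by
      intro i
      have := congrFun hv i
      simp only [Matrix.mulVec, dotProduct, Matrix.of_apply, Pi.zero_apply] at this
      rw [Polynomial.IsRoot, hP, Polynomial.eval_finsetSum, ← this]
      refine Finset.sum_congr rfl fun j _ => ?_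
      rw [Polynomial.eval_mul, Polynomial.eval_C, Polynomial.eval_pow, Polynomial.eval_X, pow_mul,
        mul_comm]
    have hinj : Function.Injective fun i => ζ ^ k i := by
      intro a b hab
      apply hk
      have := (hζ.isOfFinOrder hp.ne_zero).pow_eq_pow_iff_modEq.1 hab
      rw [← hζ.eq_orderOf] at this
      exact (ZMod.natCast_eq_natCast_iff _ _ _).2 this
    have hdvd : ∏ i, (Polynomial.X - Polynomial.C (ζ ^ k i)) ∣ P := by
      by_cases hP0 : P = 0
      · rw [hP0]
        exact dvd_zero _
      · have := (Multiset.prod_X_sub_C_dvd_iff_le_roots hP0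
          (Finset.univ.val.map fun i => ζ ^ k i)).2 ?_
        · rw [Multiset.map_map] at this
          exact this
        · rw [Multiset.le_iff_subset (Finset.univ.nodup.map hinj)]
          intro x hx
          obtain ⟨i, -, rfl⟩ := Multiset.mem_map.1 hx
          exact (Polynomial.mem_roots hP0).2 (hroot i)
    have hdvd2 : (Polynomial.X - 1) ^ n ∣
        ∑ j, Polynomial.C (Ideal.Quotient.mk I (v j)) * Polynomial.X ^ l j := by
      have := map_dvd (Polynomial.mapRingHom (Ideal.Quotient.mk I)) hdvd
      simpa [hP, map_prod, map_sum, hz1] using this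
    have h0 := Matrix.eq_zero_of_forall_pow_sum_mul_pow_eq_zero hl'
      (v := fun j => Ideal.Quotient.mk I (v j)) (fun r => by
        exact sum_mul_pow_eq_zero_of_sub_one_pow_dvd l n r r.2 _ hdvd2)
    intro j
    have := congrFun h0 j
    simpa [Ideal.Quotient.eq_zero_iff_mem, hI, Ideal.mem_span_singleton] using this
  -- Hence all entries would be divisible by every power of `ζ - 1`.
  have key2 : ∀ m : ℕ, ∀ j, (ζ - 1) ^ m ∣ v j := by
    intro m
    induction m with
    | zero => simp
    | succ m ih =>
      choose u hu using ih
      have hu0 : (Matrix.of fun i j => ζ ^ (k i * l j)).mulVec u = 0 := by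
        have : v = (ζ - 1) ^ m • u := funext hu
        rw [this, Matrix.mulVec_smul] at hv
        exact (smul_eq_zero.1 hv).resolve_left (pow_ne_zero _ hprime.ne_zero)
      intro j
      rw [hu j, pow_succ]
      exact mul_dvd_mul_left _ (key u hu0 j)
  obtain ⟨j, hj⟩ := Function.ne_iff.1 hv0
  exact (FiniteMultiplicity.of_not_isUnit hprime.not_isUnit hj).not_pow_dvd_of_multiplicity_lt
    (Nat.lt_succ_self _) (key2 _ j)

theorem det_pow_mul_ne_zero_of_isCyclotomicExtension (K : Type*) [Field K] [CharZero K]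
    {p : ℕ} (hp : p.Prime) [IsCyclotomicExtension {p} ℚ K] {ω : ℂ}
    (hω : IsPrimitiveRoot ω p) {n : ℕ} (k l : Fin n → ℕ)
    (hk : Function.Injective fun i => (k i : ZMod p))
    (hl : Function.Injective fun i => (l i : ZMod p)) :
    (Matrix.of fun i j => ω ^ (k i * l j)).det ≠ 0 := by
  have := Fact.mk hp
  have : NeZero p := ⟨hp.ne_zero⟩
  have : NumberField K := IsCyclotomicExtension.numberField {p} ℚ K
  have hz := IsCyclotomicExtension.zeta_spec p ℚ K
  obtain ⟨φ, hφ⟩ : ∃ φ : K →ₐ[ℚ] ℂ, φ (IsCyclotomicExtension.zeta p ℚ K) = ω := by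
    have hirr := Polynomial.cyclotomic.irreducible_rat hp.pos
    refine ⟨(hz.embeddingsEquivPrimitiveRoots ℂ hirr).symm
      ⟨ω, (mem_primitiveRoots hp.pos).2 hω⟩, ?_⟩
    rw [← hz.embeddingsEquivPrimitiveRoots_apply_coe ℂ hirr, Equiv.apply_symm_apply]
  have h := det_pow_mul_ne_zero_of_prime_sub_one hp hz.toInteger_isPrimitiveRoot
    hz.zeta_sub_one_prime' k l hk hl
  set ψ := φ.toRingHom.comp (algebraMap (NumberField.RingOfIntegers K) K)
  have hinj : Function.Injective ψ :=
    φ.toRingHom.injective.comp NumberField.RingOfIntegers.coe_injective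
  have h2 := (map_ne_zero_iff ψ hinj).2 h
  rw [RingHom.map_det] at h2
  convert h2 using 2
  ext i j
  simp only [RingHom.mapMatrix_apply, Matrix.map_apply, Matrix.of_apply, map_pow]
  rw [← hφ]
  rfl

/-- **Chebotarev's theorem on roots of unity**: every minor of the Fourier matrix of prime order
is nonzero. -/
theorem det_pow_mul_ne_zero_of_prime {p : ℕ} (hp : p.Prime) {ω : ℂ}
    (hω : IsPrimitiveRoot ω p) {n : ℕ} (k l : Fin n → ℕ)
    (hk : Function.Injective fun i => (k i : ZMod p))
    (hl : Function.Injective fun i => (l i : ZMod p)) :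
    (Matrix.of fun i j => ω ^ (k i * l j)).det ≠ 0 := by
  have : IsCyclotomicExtension {p} ℚ (CyclotomicField p ℚ) := by
    have : NeZero (p : ℚ) := ⟨Nat.cast_ne_zero.2 hp.ne_zero⟩
    have : NeZero p := ⟨hp.ne_zero⟩
    exact CyclotomicField.isCyclotomicExtension p ℚ
  exact det_pow_mul_ne_zero_of_isCyclotomicExtension (CyclotomicField p ℚ) hp hω k l hk hl

/-! ### Riesz bases through finite sums -/

section RieszCriterion

variable {ι H : Type*} [NormedAddCommGroup H] [InnerProductSpace ℂ H]

theorem isCompleteFamily_iff [CompleteSpace H] (f : ι → H) :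
    IsCompleteFamily f ↔ ∀ v : H, (∀ i, inner ℂ (f i) v = 0) → v = 0 := by
  rw [IsCompleteFamily, Submodule.dense_iff_topologicalClosure_eq_top,
    Submodule.topologicalClosure_eq_top_iff, Submodule.eq_bot_iff]
  refine forall_congr' fun v => ?_
  rw [Submodule.mem_orthogonal]
  refine imp_congr_left ⟨fun h i => h _ (Submodule.subset_span ⟨i, rfl⟩), fun h u hu => ?_⟩
  induction hu using Submodule.span_induction with
  | mem x hx => obtain ⟨i, rfl⟩ := hx; exact h i
  | zero => simp
  | add x y _ _ hx hy => rw [inner_add_left, hx, hy, add_zero]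
  | smul a x _ hx => rw [inner_smul_left, hx, mul_zero]

theorem IsRieszSequence.exists_finset_lower_bound {f : ι → H} (h : IsRieszSequence f) :
    ∃ A : ℝ, 0 < A ∧ ∀ (s : Finset ι) (c : ι → ℂ),
      A * ∑ i ∈ s, ‖c i‖ ^ 2 ≤ ‖∑ i ∈ s, c i • f i‖ ^ 2 := by
  classical
  obtain ⟨A, B, hA, -, h⟩ := h
  refine ⟨A, hA, fun s c => ?_⟩
  set d : lp (fun _ : ι => ℂ) 2 := ∑ i ∈ s, lp.single 2 i (c i) with hd
  have hdi : ∀ i, d i = if i ∈ s then c i else 0 := by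
    intro i
    rw [hd, lp.coeFn_sum, Finset.sum_apply]
    simp [Pi.single_apply]
  have h1 : ∑' i, d i • f i = ∑ i ∈ s, c i • f i := by
    rw [tsum_eq_sum (s := s) (fun i hi => by rw [hdi, if_neg hi, zero_smul])]
    exact Finset.sum_congr rfl fun i hi => by rw [hdi, if_pos hi]
  have h2 : ‖d‖ ^ 2 = ∑ i ∈ s, ‖c i‖ ^ 2 := by
    have := lp.norm_sum_single (p := 2) (by norm_num) c s
    simpa using this
  have := (h d).2.1
  rwa [h1, h2] at this

theorem isRieszSequence_of_finset_bounds [CompleteSpace H] {f : ι → H} {A B : ℝ} (hA : 0 < A)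
    (h : ∀ (s : Finset ι) (c : ι → ℂ), A * ∑ i ∈ s, ‖c i‖ ^ 2 ≤ ‖∑ i ∈ s, c i • f i‖ ^ 2 ∧
      ‖∑ i ∈ s, c i • f i‖ ^ 2 ≤ B * ∑ i ∈ s, ‖c i‖ ^ 2) :
    IsRieszSequence f := by
  refine ⟨A, max A B, hA, le_max_left _ _, fun c => ?_⟩
  have hB : ∀ (s : Finset ι) (c : ι → ℂ),
      ‖∑ i ∈ s, c i • f i‖ ^ 2 ≤ max A B * ∑ i ∈ s, ‖c i‖ ^ 2 := fun s c =>
    (h s c).2.trans (mul_le_mul_of_nonneg_right (le_max_right _ _)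
      (Finset.sum_nonneg fun i _ => by positivity))
  have hB0 : 0 < max A B := lt_max_of_lt_left hA
  have hc : HasSum (fun i => ‖c i‖ ^ 2) (‖c‖ ^ 2) := by
    have := lp.hasSum_norm (p := 2) (by norm_num) c
    simpa using this
  have hsum : Summable fun i => c i • f i := by
    rw [summable_iff_vanishing_norm]
    intro ε hε
    obtain ⟨s, hs⟩ := summable_iff_vanishing_norm.1 hc.summable (ε ^ 2 / max A B) (by positivity)
    refine ⟨s, fun t ht => ?_⟩
    have h1 := hs t ht
    rw [Real.norm_of_nonneg (Finset.sum_nonneg fun i _ => by positivity), lt_div_iff₀ hB0,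
      mul_comm] at h1
    exact lt_of_pow_lt_pow_left₀ 2 hε.le ((hB t c).trans_lt h1)
  have hlim := (hsum.hasSum.norm).pow 2
  exact ⟨hsum, le_of_tendsto_of_tendsto' (hc.const_mul A) hlim
      (fun s => by simpa only [Finset.mul_sum] using (h s fun i => c i).1),
    le_of_tendsto_of_tendsto' hlim (hc.const_mul (max A B))
      (fun s => by simpa only [Finset.mul_sum] using hB s fun i => c i)⟩

end RieszCriterion

/-! ### Exponential systems -/

theorem continuous_expFun (l : ℝ) : Continuous (expFun l) := by
  unfold expFun; fun_prop

theorem norm_expFun (l t : ℝ) : ‖expFun l t‖ = 1 := by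
  have : expFun l t = Complex.exp ((2 * Real.pi * l * t : ℝ) * Complex.I) := by
    unfold expFun; congr 1; push_cast; ring
  rw [this, Complex.norm_exp_ofReal_mul_I]

theorem expFun_add_left (l k t : ℝ) : expFun (l + k) t = expFun l t * expFun k t := by
  unfold expFun; rw [← Complex.exp_add]; congr 1; push_cast; ring

theorem expFun_add_right (l t a : ℝ) : expFun l (t + a) = expFun l t * expFun l a := by
  unfold expFun; rw [← Complex.exp_add]; congr 1; push_cast; ring

theorem conj_expFun (l t : ℝ) : (starRingEnd ℂ) (expFun l t) = expFun (-l) t := by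
  unfold expFun; rw [← Complex.exp_conj]; congr 1
  simp only [map_mul, Complex.conj_ofReal, Complex.conj_I, map_ofNat]
  push_cast
  ring

theorem expFun_eq_one {l t : ℝ} (z : ℤ) (h : l * t = z) : expFun l t = 1 := by
  unfold expFun
  rw [Complex.exp_eq_one_iff]
  refine ⟨z, ?_⟩
  rw [← Complex.ofReal_intCast, ← h]; push_cast; ring

theorem memLp_expFun (l : ℝ) {S : Set ℝ} (hS : volume S ≠ ⊤) :
    MemLp (expFun l) 2 (volume.restrict S) := by
  have : IsFiniteMeasure (volume.restrict S) := ⟨by simpa using hS.lt_top⟩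
  exact MemLp.of_bound (continuous_expFun l).aestronglyMeasurable 1
    (Filter.Eventually.of_forall fun t => (norm_expFun l t).le)

/-- The exponentials with frequencies in `Λ` satisfy the lower Riesz inequality on `S`, tested on
finite sums: the coefficients are controlled by the `L²(S)` norm. The constant stands on the side
of the integral, so that it is finite rather than positive. -/
def ExpLowerBound (C : NNReal) (Λ S : Set ℝ) : Prop :=
  ∀ s : Finset ℝ, (s : Set ℝ) ⊆ Λ → ∀ c : ℝ → ℂ,
    ∑ l ∈ s, ‖c l‖ₑ ^ 2 ≤ C * ∫⁻ t in S, ‖∑ l ∈ s, c l * expFun l t‖ₑ ^ 2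

/-- The exponentials with frequencies in `Λ` are complete in `L²(S)`: only `0` is orthogonal to
all of them. -/
def ExpTotal (Λ S : Set ℝ) : Prop :=
  ∀ v : ℝ → ℂ, MemLp v 2 (volume.restrict S) →
    (∀ l ∈ Λ, ∫ t in S, expFun (-l) t * v t = 0) → v =ᵐ[volume.restrict S] 0

theorem ExpLowerBound.translate {C : NNReal} {Λ S : Set ℝ} (h : ExpLowerBound C Λ S) (k : ℝ) :
    ExpLowerBound C (translateSet Λ k) S := by
  classical
  intro s hs c
  have h1 := h (s.image fun l => l - k) (by
    intro l hl
    obtain ⟨l', hl', rfl⟩ := Finset.mem_image.1 (Finset.mem_coe.1 hl)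
    obtain ⟨m, hm, rfl⟩ := hs hl'
    simpa only [add_sub_cancel_right] using hm) (fun l => c (l + k))
  have hinj : Set.InjOn (fun l : ℝ => l - k) s := fun a _ b _ hab => by simpa using hab
  rw [Finset.sum_image hinj] at h1
  simp only [sub_add_cancel] at h1
  refine h1.trans_eq ?_
  congr 1
  refine lintegral_congr fun t => ?_
  rw [Finset.sum_image hinj]
  have : ∑ l ∈ s, c l * expFun l t
      = (∑ l ∈ s, c (l - k + k) * expFun (l - k) t) * expFun k t := by
    rw [Finset.sum_mul]
    refine Finset.sum_congr rfl fun l _ => ?_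
    rw [mul_assoc, ← expFun_add_left, sub_add_cancel]
  rw [this, enorm_mul]
  have h1 : ‖expFun k t‖ₑ = 1 := by rw [← ofReal_norm, norm_expFun, ENNReal.ofReal_one]
  rw [h1, mul_one]

theorem ExpTotal.translate {Λ S : Set ℝ} (h : ExpTotal Λ S) (k : ℝ) :
    ExpTotal (translateSet Λ k) S := by
  intro v hv hl
  have h1 := h (fun t => expFun (-k) t * v t)
    (hv.of_le ((continuous_expFun _).aestronglyMeasurable.mul hv.1)
      (Filter.Eventually.of_forall fun t => by rw [norm_mul, norm_expFun, one_mul]))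
    (fun l hll => by
      rw [← hl (l + k) ⟨l, hll, rfl⟩]
      refine integral_congr_ae (Filter.Eventually.of_forall fun t => ?_)
      simp only
      rw [neg_add, expFun_add_left, mul_assoc])
  filter_upwards [h1] with t ht
  have h2 : expFun (-k) t ≠ 0 := by rw [← norm_ne_zero_iff, norm_expFun]; exact one_ne_zero
  exact (mul_eq_zero.1 ht).resolve_left h2

section
variable {Λ S : Set ℝ} (h : ∀ l : Λ, MemLp (expFun l) 2 (volume.restrict S))

theorem norm_sq_sum_toLp (s : Finset Λ) (c : Λ → ℂ) :
    ENNReal.ofReal (‖∑ i ∈ s, c i • (h i).toLp (expFun i)‖ ^ 2)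
      = ∫⁻ t in S, ‖∑ i ∈ s, c i * expFun i t‖ₑ ^ 2 := by
  have hmem : MemLp (fun t => ∑ i ∈ s, c i * expFun i t) 2 (volume.restrict S) :=
    memLp_finsetSum s fun i _ => (h i).const_mul (c i)
  have : ∑ i ∈ s, c i • (h i).toLp (expFun i) = hmem.toLp _ := by
    apply Lp.ext
    refine (Lp.coeFn_finsetSum _ _).trans ?_
    have h2 : ∀ i ∈ s, ∀ᵐ t ∂volume.restrict S,
        (c i • (h i).toLp (expFun i) : Lp ℂ 2 (volume.restrict S)) t = c i * expFun i t := by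
      intro i _
      filter_upwards [Lp.coeFn_smul (c i) ((h i).toLp (expFun i)), (h i).coeFn_toLp] with t h1 h2
      rw [h1, Pi.smul_apply, h2, smul_eq_mul]
    filter_upwards [hmem.coeFn_toLp, (Filter.eventually_all_finset s).2 h2] with t h1 h2
    rw [h1, Finset.sum_apply]
    exact Finset.sum_congr rfl h2
  rw [this, Lp.norm_toLp, ← ENNReal.toReal_pow, ENNReal.ofReal_toReal
    (ENNReal.pow_ne_top hmem.eLpNorm_ne_top), eLpNorm_eq_lintegral_rpow_enorm_toReal
    (by norm_num) (by norm_num), ← ENNReal.rpow_natCast, ← ENNReal.rpow_mul]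
  simp

theorem inner_toLp_expFun (l : Λ) (v : Lp ℂ 2 (volume.restrict S)) :
    inner ℂ ((h l).toLp (expFun l)) v = ∫ t in S, expFun (-l) t * v t := by
  rw [L2.inner_def]
  refine integral_congr_ae ?_
  filter_upwards [(h l).coeFn_toLp] with t ht
  rw [ht, RCLike.inner_apply, conj_expFun, mul_comm]

theorem isCompleteFamily_toLp_iff :
    IsCompleteFamily (fun l : Λ => (h l).toLp (expFun l)) ↔ ExpTotal Λ S := by
  rw [isCompleteFamily_iff]
  simp only [inner_toLp_expFun]
  constructor
  · intro H v hv hl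
    have := H (hv.toLp v) (fun l => by
      rw [← hl l l.2]
      refine integral_congr_ae ?_
      filter_upwards [hv.coeFn_toLp] with t ht
      rw [ht])
    exact (MemLp.toLp_eq_toLp_iff hv MemLp.zero).1 (by rw [this]; rfl)
  · intro H v hl
    exact (Lp.eq_zero_iff_ae_eq_zero).2 (H v (Lp.memLp v) fun l hll => hl ⟨l, hll⟩)

end

theorem ExpRieszBasis.total {Λ S : Set ℝ} (h : ExpRieszBasis Λ S) : ExpTotal Λ S := by
  obtain ⟨h, h1, -⟩ := h
  exact (isCompleteFamily_toLp_iff h).1 h1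

theorem ExpRieszBasis.exists_lowerBound {Λ S : Set ℝ} (h : ExpRieszBasis Λ S) :
    ∃ C, ExpLowerBound C Λ S := by
  classical
  obtain ⟨h, -, h1⟩ := h
  obtain ⟨A, hA, h1⟩ := h1.exists_finset_lower_bound
  refine ⟨(1 / A).toNNReal, fun s hs c => ?_⟩
  have h2 := h1 (s.subtype (· ∈ Λ)) (fun l => c l)
  have e1 : ∀ {G : Type} [AddCommMonoid G] (F : ℝ → G),
      ∑ l ∈ s.subtype (· ∈ Λ), F l = ∑ l ∈ s, F l := by
    intro G _ F
    exact Finset.sum_subtype_of_mem F (fun l hl => hs hl)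
  rw [e1 (fun l => ‖c l‖ ^ 2), mul_comm, ← le_div_iff₀ hA] at h2
  have h3 := ENNReal.ofReal_le_ofReal h2
  rw [div_eq_inv_mul, ENNReal.ofReal_mul (by positivity), norm_sq_sum_toLp,
    ENNReal.ofReal_sum_of_nonneg (fun _ _ => by positivity)] at h3
  simp only [ENNReal.ofReal_pow (norm_nonneg _), ofReal_norm] at h3
  rw [one_div]
  refine h3.trans_eq ?_
  congr 1
  refine lintegral_congr fun t => ?_
  rw [e1 (fun l => c l * expFun l t)]

theorem expRieszBasis_of_bounds {Λ S : Set ℝ} (hS : volume S ≠ ⊤) {C : NNReal}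
    (hlow : ExpLowerBound C Λ S) (htot : ExpTotal Λ S)
    (hup : ∀ s : Finset ℝ, (s : Set ℝ) ⊆ Λ → ∀ c : ℝ → ℂ,
      ∫⁻ t in S, ‖∑ l ∈ s, c l * expFun l t‖ₑ ^ 2 ≤ ∑ l ∈ s, ‖c l‖ₑ ^ 2) :
    ExpRieszBasis Λ S := by
  classical
  refine ⟨fun l => memLp_expFun l hS, (isCompleteFamily_toLp_iff _).2 htot, ?_⟩
  refine isRieszSequence_of_finset_bounds (A := ((C : ℝ) + 1)⁻¹) (B := 1) (by positivity) ?_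
  intro s c
  set d : ℝ → ℂ := fun l => if hl : l ∈ Λ then c ⟨l, hl⟩ else 0 with hd
  have hdc : ∀ l : Λ, d l = c l := fun l => by simp [hd]
  have hsub : ((s.map (Function.Embedding.subtype (· ∈ Λ)) : Finset ℝ) : Set ℝ) ⊆ Λ := by
    intro l hl
    obtain ⟨l', -, rfl⟩ := Finset.mem_map.1 (Finset.mem_coe.1 hl)
    exact l'.2
  have h1 := hlow _ hsub d
  have h2 := hup _ hsub d
  simp only [Finset.sum_map, Function.Embedding.subtype_apply, hdc] at h1 h2
  have e : ∑ l ∈ s, ‖c l‖ₑ ^ 2 = ENNReal.ofReal (∑ l ∈ s, ‖c l‖ ^ 2) := by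
    rw [ENNReal.ofReal_sum_of_nonneg (fun _ _ => by positivity)]
    simp only [ENNReal.ofReal_pow (norm_nonneg _), ofReal_norm]
  have hnn : 0 ≤ ∑ l ∈ s, ‖c l‖ ^ 2 := Finset.sum_nonneg fun _ _ => by positivity
  rw [← norm_sq_sum_toLp (fun l => memLp_expFun l hS), e] at h1 h2
  constructor
  · rw [← ENNReal.ofReal_coe_nnreal, ← ENNReal.ofReal_mul (by positivity),
      ENNReal.ofReal_le_ofReal_iff (by positivity)] at h1
    rw [inv_mul_le_iff₀ (by positivity), add_mul, one_mul]
    exact h1.trans (le_add_of_nonneg_right (by positivity))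
  · rw [one_mul]
    exact (ENNReal.ofReal_le_ofReal_iff hnn).1 h2

theorem integral_expFun {N : ℕ} (hN : 0 < N) {m : ℝ} (z : ℤ) (hm : m = N * z) :
    ∫ t in (0 : ℝ)..1 / N, expFun m t = if m = 0 then (1 / N : ℂ) else 0 := by
  have hN' : (N : ℝ) ≠ 0 := Nat.cast_ne_zero.2 hN.ne'
  split_ifs with h0
  · simp [expFun, h0]
  · have hc : (2 * Real.pi * Complex.I * m : ℂ) ≠ 0 := by
      simp [Real.pi_ne_zero, h0]
    have := integral_exp_mul_complex (a := 0) (b := 1 / N) hc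
    unfold expFun
    rw [this]
    have h1 : Complex.exp (2 * Real.pi * Complex.I * m * ((1 / N : ℝ) : ℂ)) = 1 :=
      expFun_eq_one z (by rw [hm]; field_simp)
    rw [h1]
    simp

/-- Parseval's identity on `[0, 1/N)` for exponentials whose frequencies differ by multiples
of `N`. -/
theorem lintegral_sum_expFun {N : ℕ} (hN : 0 < N) (s : Finset ℝ)
    (hs : ∀ l ∈ s, ∀ l' ∈ s, ∃ z : ℤ, l - l' = N * z) (c : ℝ → ℂ) :
    ∑ l ∈ s, ‖c l‖ₑ ^ 2
      = N * ∫⁻ t in Set.Ico (0 : ℝ) (1 / N), ‖∑ l ∈ s, c l * expFun l t‖ₑ ^ 2 := by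
  have hN' : (N : ℝ) ≠ 0 := Nat.cast_ne_zero.2 hN.ne'
  set g : ℝ → ℂ := fun t => ∑ l ∈ s, c l * expFun l t with hg
  have hgc : Continuous g :=
    continuous_finsetSum _ fun l _ => continuous_const.mul (continuous_expFun l)
  have h1 : ∫ t in (0 : ℝ)..1 / N, ((‖g t‖ ^ 2 : ℝ) : ℂ)
      = 1 / N * ∑ l ∈ s, ((‖c l‖ ^ 2 : ℝ) : ℂ) := by
    have e : ∀ t, ((‖g t‖ ^ 2 : ℝ) : ℂ) = ∑ l ∈ s, ∑ l' ∈ s,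
        c l * (starRingEnd ℂ) (c l') * expFun (l - l') t := by
      intro t
      rw [Complex.ofReal_pow, ← Complex.mul_conj', hg]
      simp only [map_sum, map_mul, conj_expFun, Finset.sum_mul_sum, sub_eq_add_neg,
        expFun_add_left]
      refine Finset.sum_congr rfl fun l _ => Finset.sum_congr rfl fun l' _ => ?_
      ring
    simp only [e]
    rw [intervalIntegral.integral_finsetSum fun l _ => by
      apply Continuous.intervalIntegrable
      exact continuous_finsetSum _ fun l' _ => continuous_const.mul (continuous_expFun _),
      Finset.mul_sum]
    refine Finset.sum_congr rfl fun l hl => ?_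
    rw [intervalIntegral.integral_finsetSum fun l' _ => by
      apply Continuous.intervalIntegrable
      exact continuous_const.mul (continuous_expFun _)]
    rw [Finset.sum_eq_single l]
    · obtain ⟨z, hz⟩ := hs l hl l hl
      rw [intervalIntegral.integral_const_mul, integral_expFun hN z hz, if_pos (sub_self l),
        Complex.mul_conj', Complex.ofReal_pow, mul_comm]
    · intro l' hl' hne
      obtain ⟨z, hz⟩ := hs l hl l' hl'
      rw [intervalIntegral.integral_const_mul, integral_expFun hN z hz,
        if_neg (sub_ne_zero.2 hne.symm), mul_zero]
    · exact fun h => absurd hl h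
  have h2 : ∫ t in Set.Ico (0 : ℝ) (1 / N), ‖g t‖ ^ 2 = 1 / N * ∑ l ∈ s, ‖c l‖ ^ 2 := by
    rw [integral_Ico_eq_integral_Ioc, ← intervalIntegral.integral_of_le (by positivity)]
    rw [intervalIntegral.integral_ofReal] at h1
    -- `norm_cast` needs this to move the quotient `1 / N` through the cast.
    have hNc : (N : ℂ) ≠ 0 := Nat.cast_ne_zero.2 hN.ne'
    exact_mod_cast h1
  have hint : Integrable (fun t => ‖g t‖ ^ 2) (volume.restrict (Set.Ico (0 : ℝ) (1 / N))) :=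
    ((hgc.norm.pow 2).continuousOn.integrableOn_compact isCompact_Icc).mono_set
      Set.Ico_subset_Icc_self
  have h3 := ofReal_integral_eq_lintegral_ofReal hint
    (Filter.Eventually.of_forall fun t => by positivity)
  simp only [ENNReal.ofReal_pow (norm_nonneg _), ofReal_norm] at h3
  rw [← h3, h2, ← ENNReal.ofReal_natCast, ← ENNReal.ofReal_mul (by positivity), ← mul_assoc,
    mul_one_div_cancel hN', one_mul, ENNReal.ofReal_sum_of_nonneg (fun _ _ => by positivity)]
  simp only [ENNReal.ofReal_pow (norm_nonneg _), ofReal_norm]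

/-! ### Matrices with nonvanishing leading minors acting on nested sets -/

/-- All leading principal minors of sizes at most `n` of the array `W` are nonzero. -/
def LeadingMinorsNeZero (W : ℕ → ℕ → ℂ) (n : ℕ) : Prop :=
  ∀ r ≤ n, (Matrix.of fun i j : Fin r => W i j).det ≠ 0

namespace LeadingMinorsNeZero

variable {W : ℕ → ℕ → ℂ} {n : ℕ}

theorem mono (h : LeadingMinorsNeZero W n) {m : ℕ} (hm : m ≤ n) : LeadingMinorsNeZero W m :=
  fun r hr => h r (hr.trans hm)

theorem conj (h : LeadingMinorsNeZero W n) :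
    LeadingMinorsNeZero (fun i j => (starRingEnd ℂ) (W i j)) n := by
  intro r hr h0
  have h1 := RingHom.map_det (starRingEnd ℂ) (Matrix.of fun i j : Fin r => W i j)
  have h2 : (starRingEnd ℂ).mapMatrix (Matrix.of fun i j : Fin r => W i j)
      = Matrix.of fun i j : Fin r => (starRingEnd ℂ) (W i j) := by ext; simp
  rw [h2, h0] at h1
  exact h r hr ((map_eq_zero _).1 h1)

theorem eq_zero_of_sum_eq_zero (h : LeadingMinorsNeZero W n) {r : ℕ} (hr : r ≤ n) {y : ℕ → ℂ}
    (hy : ∀ i < r, ∑ j ∈ Finset.range r, W i j * y j = 0) : ∀ j < r, y j = 0 := by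
  have h1 := Matrix.eq_zero_of_mulVec_eq_zero (h r hr) (v := fun j => y j) (by
    ext i
    have := hy i i.2
    rw [Finset.sum_range] at this
    simpa [Matrix.mulVec, dotProduct] using this)
  intro j hj
  exact congrFun h1 ⟨j, hj⟩

/-- The last coordinate of a vector is controlled by its image under an invertible matrix. -/
theorem exists_last_le (h : LeadingMinorsNeZero W (n + 1)) : ∃ K : NNReal, ∀ x : ℕ → ℂ,
    ‖x n‖ₑ ^ 2 ≤ K * ∑ j ∈ Finset.range (n + 1), ‖∑ i ∈ Finset.range (n + 1), W i j * x i‖ₑ ^ 2 := by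
  set A : Matrix (Fin (n + 1)) (Fin (n + 1)) ℂ := Matrix.of fun i j => W i j with hA
  have hdet : IsUnit A.det := (h (n + 1) le_rfl).isUnit
  refine ⟨∑ j, ‖A⁻¹ j (Fin.last n)‖₊ ^ 2, fun x => ?_⟩
  have key : x n = ∑ j : Fin (n + 1), (∑ i : Fin (n + 1), W i j * x i) * A⁻¹ j (Fin.last n) := by
    have h1 : Matrix.vecMul (Matrix.vecMul (fun i : Fin (n + 1) => x i) A) A⁻¹ =
        fun i : Fin (n + 1) => x i := by
      rw [Matrix.vecMul_vecMul, Matrix.mul_nonsing_inv _ hdet, Matrix.vecMul_one]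
    have h2 := congrFun h1 (Fin.last n)
    simp only [Matrix.vecMul, dotProduct, Fin.val_last] at h2
    rw [← h2]
    refine Finset.sum_congr rfl fun j _ => ?_
    congr 1
    exact Finset.sum_congr rfl fun i _ => by rw [hA, Matrix.of_apply, mul_comm]
  have hreal : ‖x n‖ ^ 2 ≤ (∑ j, ‖A⁻¹ j (Fin.last n)‖ ^ 2)
      * ∑ j : Fin (n + 1), ‖∑ i : Fin (n + 1), W i j * x i‖ ^ 2 := by
    rw [key, mul_comm]
    refine le_trans ?_ (Finset.sum_mul_sq_le_sq_mul_sq Finset.univ _ _)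
    refine pow_le_pow_left₀ (norm_nonneg _) ?_ 2
    refine (norm_sum_le _ _).trans_eq ?_
    simp only [norm_mul]
  simp only [Finset.sum_range, enorm_eq_nnnorm]
  norm_cast
  rw [← NNReal.coe_le_coe]
  push_cast
  exact hreal

end LeadingMinorsNeZero

/-- If each `p i` has its norm controlled by its restriction to `S i`, the sets `S i` decrease and
the leading minors of `W` do not vanish, then the `p i` are controlled by the combinations
`∑ i, W i j * p i` restricted to `S j`. On the smallest set all combinations are available, which
controls the last function there and hence everywhere; it is then subtracted, and the remaining
functions form a smaller system. -/
theorem LeadingMinorsNeZero.exists_lintegral_le {X : Type*} [MeasurableSpace X] (μ : Measure X)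
    {W : ℕ → ℕ → ℂ} {S : ℕ → Set X} (C : NNReal) {n : ℕ} (hW : LeadingMinorsNeZero W n)
    (hS : ∀ i j, i ≤ j → j < n → S j ⊆ S i) :
    ∃ D : NNReal, ∀ p : ℕ → X → ℂ, (∀ i < n, Measurable (p i)) →
      (∀ i < n, ∫⁻ x, ‖p i x‖ₑ ^ 2 ∂μ ≤ C * ∫⁻ x in S i, ‖p i x‖ₑ ^ 2 ∂μ) →
      ∑ i ∈ Finset.range n, ∫⁻ x, ‖p i x‖ₑ ^ 2 ∂μ ≤
        D * ∑ j ∈ Finset.range n,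
          ∫⁻ x in S j, ‖∑ i ∈ Finset.range n, W i j * p i x‖ₑ ^ 2 ∂μ := by
  induction n with
  | zero => exact ⟨0, by simp⟩
  | succ n ih =>
    obtain ⟨D, hD⟩ := ih (hW.mono n.le_succ) fun i j hij hj => hS i j hij (hj.trans n.lt_succ_self)
    obtain ⟨K, hK⟩ := hW.exists_last_le
    set L : NNReal := C * K
    set V : NNReal := ∑ j ∈ Finset.range n, ‖W n j‖₊ ^ 2
    refine ⟨D * (2 * (1 + V * L)) + L, fun p hpm hp => ?_⟩
    set F := ∑ j ∈ Finset.range (n + 1),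
      ∫⁻ x in S j, ‖∑ i ∈ Finset.range (n + 1), W i j * p i x‖ₑ ^ 2 ∂μ with hF
    have hmeas : ∀ j, Measurable fun x =>
        ‖∑ i ∈ Finset.range (n + 1), W i j * p i x‖ₑ ^ 2 := fun j =>
      ((Finset.measurable_fun_sum _ fun i hi =>
        (hpm i (Finset.mem_range.1 hi)).const_mul _).enorm).pow_const 2
    -- The last function, on the smallest set and then everywhere.
    have hlast : ∫⁻ x, ‖p n x‖ₑ ^ 2 ∂μ ≤ L * F := by
      refine (hp n n.lt_succ_self).trans ?_
      rw [ENNReal.coe_mul, mul_assoc]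
      gcongr
      calc ∫⁻ x in S n, ‖p n x‖ₑ ^ 2 ∂μ
          ≤ ∫⁻ x in S n, K * ∑ j ∈ Finset.range (n + 1),
              ‖∑ i ∈ Finset.range (n + 1), W i j * p i x‖ₑ ^ 2 ∂μ :=
            lintegral_mono fun x => hK fun i => p i x
        _ = K * ∑ j ∈ Finset.range (n + 1), ∫⁻ x in S n,
              ‖∑ i ∈ Finset.range (n + 1), W i j * p i x‖ₑ ^ 2 ∂μ := by
            rw [lintegral_const_mul _ (Finset.measurable_fun_sum _ fun j _ => hmeas j),
              lintegral_finsetSum _ fun j _ => hmeas j]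
        _ ≤ K * F := by
            refine mul_le_mul_right (Finset.sum_le_sum fun j hj => ?_) _
            exact lintegral_mono_set
              (hS j n (Nat.lt_succ_iff.1 (Finset.mem_range.1 hj)) n.lt_succ_self)
    -- Subtraction of the last function.
    have hsub : ∑ j ∈ Finset.range n,
        ∫⁻ x in S j, ‖∑ i ∈ Finset.range n, W i j * p i x‖ₑ ^ 2 ∂μ ≤ 2 * (1 + V * L) * F := by
      have hpt : ∀ j x, ‖∑ i ∈ Finset.range n, W i j * p i x‖ₑ ^ 2
          ≤ 2 * ‖∑ i ∈ Finset.range (n + 1), W i j * p i x‖ₑ ^ 2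
            + 2 * ‖W n j‖ₑ ^ 2 * ‖p n x‖ₑ ^ 2 := by
        intro j x
        have hreal : ‖∑ i ∈ Finset.range n, W i j * p i x‖ ^ 2
            ≤ 2 * ‖∑ i ∈ Finset.range (n + 1), W i j * p i x‖ ^ 2
              + 2 * ‖W n j‖ ^ 2 * ‖p n x‖ ^ 2 := by
          rw [Finset.sum_range_succ]
          set a := ∑ i ∈ Finset.range n, W i j * p i x
          have h1 : ‖a‖ ≤ ‖a + W n j * p n x‖ + ‖W n j‖ * ‖p n x‖ := by
            rw [← norm_mul]
            simpa using norm_sub_le (a + W n j * p n x) (W n j * p n x)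
          have h2 := pow_le_pow_left₀ (norm_nonneg a) h1 2
          nlinarith [sq_nonneg (‖a + W n j * p n x‖ - ‖W n j‖ * ‖p n x‖)]
        simp only [enorm_eq_nnnorm]
        exact_mod_cast hreal
      have hj : ∀ j ∈ Finset.range n,
          ∫⁻ x in S j, ‖∑ i ∈ Finset.range n, W i j * p i x‖ₑ ^ 2 ∂μ
          ≤ 2 * (∫⁻ x in S j, ‖∑ i ∈ Finset.range (n + 1), W i j * p i x‖ₑ ^ 2 ∂μ)
            + 2 * ‖W n j‖ₑ ^ 2 * (L * F) := by
        intro j _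
        refine (lintegral_mono fun x => hpt j x).trans ?_
        rw [lintegral_add_left ((hmeas j).const_mul 2), lintegral_const_mul _ (hmeas j),
          lintegral_const_mul _ ((hpm n n.lt_succ_self).enorm.pow_const 2)]
        gcongr
        exact (setLIntegral_le_lintegral _ _).trans hlast
      refine (Finset.sum_le_sum hj).trans ?_
      have hV : (V : ENNReal) = ∑ j ∈ Finset.range n, ‖W n j‖ₑ ^ 2 := by
        simp only [V, enorm_eq_nnnorm]
        push_cast
        rfl
      rw [Finset.sum_add_distrib, ← Finset.mul_sum, ← Finset.sum_mul, ← Finset.mul_sum, ← hV]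
      have hle : ∑ j ∈ Finset.range n,
          ∫⁻ x in S j, ‖∑ i ∈ Finset.range (n + 1), W i j * p i x‖ₑ ^ 2 ∂μ ≤ F :=
        Finset.sum_le_sum_of_subset (Finset.range_mono n.le_succ)
      calc _ ≤ 2 * F + 2 * (V : ENNReal) * (L * F) := by gcongr
        _ = _ := by ring
    rw [Finset.sum_range_succ]
    have h1 := hD p (fun i hi => hpm i (hi.trans n.lt_succ_self))
      (fun i hi => hp i (hi.trans n.lt_succ_self))
    calc _ ≤ (D : ENNReal) * (2 * (1 + V * L) * F) + L * F :=
          add_le_add (h1.trans (by gcongr)) hlast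
      _ = _ := by push_cast; ring

/-- If `v j` vanishes outside `S j`, the sets `S j` decrease, the leading minors of `W` do not
vanish, and each combination `∑ j, W i j * v j` vanishes as soon as it vanishes outside `S i`,
then all `v j` vanish. Once the first `i` combinations vanish, invertibility of the leading minor
of size `i` shows that all `v j` vanish outside `S i`, where only the first `i` of them are
present; hence the next combination vanishes there, and so everywhere. -/
theorem LeadingMinorsNeZero.ae_eq_zero {X : Type*} [MeasurableSpace X] {μ : Measure X}
    {W : ℕ → ℕ → ℂ} {S : ℕ → Set X} {n : ℕ} (hW : LeadingMinorsNeZero W n)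
    (hS : ∀ i j, i ≤ j → j < n → S j ⊆ S i) {v : ℕ → X → ℂ}
    (hv : ∀ j < n, ∀ x ∉ S j, v j x = 0)
    (hq : ∀ i < n, (∀ᵐ x ∂μ, x ∉ S i → ∑ j ∈ Finset.range n, W i j * v j x = 0) →
      ∀ᵐ x ∂μ, ∑ j ∈ Finset.range n, W i j * v j x = 0) :
    ∀ᵐ x ∂μ, ∀ j < n, v j x = 0 := by
  have key : ∀ r ≤ n, ∀ᵐ x ∂μ, ∀ i < r, ∑ j ∈ Finset.range n, W i j * v j x = 0 := by
    intro r hr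
    induction r with
    | zero => simp
    | succ r ih =>
      have h1 := ih (by omega)
      have h2 := hq r (by omega) (by
        filter_upwards [h1] with x hx hxS
        have hlarge : ∀ j, r ≤ j → j < n → v j x = 0 := fun j hrj hj =>
          hv j hj x fun hxj => hxS (hS r j hrj hj hxj)
        have hsmall : ∀ j < r, v j x = 0 := by
          refine hW.eq_zero_of_sum_eq_zero (y := fun j => v j x) (by omega) fun i hi => ?_
          rw [← hx i hi]
          refine Finset.sum_subset (Finset.range_mono (by omega)) fun j hj hj' => ?_
          rw [hlarge j (by simpa using hj') (Finset.mem_range.1 hj), mul_zero]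
        refine Finset.sum_eq_zero fun j hj => ?_
        rcases lt_or_ge j r with h | h
        · rw [hsmall j h, mul_zero]
        · rw [hlarge j h (Finset.mem_range.1 hj), mul_zero])
      filter_upwards [h1, h2] with x hx1 hx2 i hi
      rcases Nat.lt_succ_iff_lt_or_eq.1 hi with h | rfl
      exacts [hx1 i h, hx2]
  filter_upwards [key n le_rfl] with x hx
  exact hW.eq_zero_of_sum_eq_zero (y := fun j => v j x) le_rfl hx

/-! ### Translates and their unions -/

theorem translateSet_eq_preimage (X : Set ℝ) (a : ℝ) :
    translateSet X a = (fun x => x - a) ⁻¹' X := by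
  ext x
  constructor
  · rintro ⟨y, hy, rfl⟩
    simpa using hy
  · intro hx
    exact ⟨x - a, hx, sub_add_cancel x a⟩

theorem MeasurableSet.translateSet {X : Set ℝ} (hX : MeasurableSet X) (a : ℝ) :
    MeasurableSet (translateSet X a) := by
  rw [translateSet_eq_preimage]
  exact measurable_id.sub_const a hX

theorem measurePreserving_restrict_translateSet (X : Set ℝ) (a : ℝ) :
    MeasurePreserving (fun x : ℝ => x + a) (volume.restrict X)
      (volume.restrict (translateSet X a)) :=
  (measurePreserving_add_right volume a).restrict_image_emb (measurableEmbedding_addRight a) X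

section Union

variable {n : ℕ} {S : ℕ → Set ℝ} {a : ℕ → ℝ}

theorem lintegral_iUnion_translateSet (hS : ∀ j < n, MeasurableSet (S j))
    (hd : Set.PairwiseDisjoint (Finset.range n : Set ℕ) fun j => translateSet (S j) (a j))
    (f : ℝ → ENNReal) :
    ∫⁻ t in ⋃ j ∈ Finset.range n, translateSet (S j) (a j), f t
      = ∑ j ∈ Finset.range n, ∫⁻ t in S j, f (t + a j) := by
  rw [lintegral_biUnion_finset hd fun j hj => (hS j (Finset.mem_range.1 hj)).translateSet _]
  refine Finset.sum_congr rfl fun j _ => ?_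
  exact ((measurePreserving_restrict_translateSet _ _).lintegral_comp_emb
    (measurableEmbedding_addRight _) f).symm

theorem integral_iUnion_translateSet (hS : ∀ j < n, MeasurableSet (S j))
    (hd : Set.PairwiseDisjoint (Finset.range n : Set ℕ) fun j => translateSet (S j) (a j))
    {f : ℝ → ℂ}
    (hf : IntegrableOn f (⋃ j ∈ Finset.range n, translateSet (S j) (a j))) :
    ∫ t in ⋃ j ∈ Finset.range n, translateSet (S j) (a j), f t
      = ∑ j ∈ Finset.range n, ∫ t in S j, f (t + a j) := by
  rw [integral_biUnion_finset _ (fun j hj => (hS j (Finset.mem_range.1 hj)).translateSet _) hd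
    fun j hj => hf.mono_set (Set.subset_biUnion_of_mem (u := fun j => translateSet (S j) (a j)) hj)]
  refine Finset.sum_congr rfl fun j _ => ?_
  exact ((measurePreserving_restrict_translateSet _ _).integral_comp
    (measurableEmbedding_addRight _) f).symm

theorem ae_restrict_iUnion_translateSet {P : ℝ → Prop}
    (h : ∀ j < n, ∀ᵐ t ∂volume.restrict (S j), P (t + a j)) :
    ∀ᵐ t ∂volume.restrict (⋃ j ∈ Finset.range n, translateSet (S j) (a j)), P t := by
  rw [ae_restrict_biUnion_finset_iff]
  intro j hj
  rw [← (measurePreserving_restrict_translateSet (S j) (a j)).map_eq,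
    (measurableEmbedding_addRight _).ae_map_iff]
  exact h j (Finset.mem_range.1 hj)

end Union

/-! ### Combining exponential systems with frequencies in different residue classes -/

/-- The data of the combination: decreasing sets `S i` in `[0, 1/N)`, systems of frequencies `Λ i`
in `Nℤ`, distinct shifts `k i` of the frequencies and distinct positions `l i` of the sets. -/
structure ShiftData (N n : ℕ) (S Λ : ℕ → Set ℝ) (k l : ℕ → ℕ) : Prop where
  pos : 0 < N
  measurable : ∀ i < n, MeasurableSet (S i)
  anti : ∀ i j, i ≤ j → j < n → S j ⊆ S i
  subset_Ico : ∀ i < n, S i ⊆ Set.Ico (0 : ℝ) (1 / N)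
  freq : ∀ i < n, Λ i ⊆ Set.range fun z : ℤ => (N : ℝ) * z
  k_mem : ∀ i < n, k i ∈ Set.Icc 1 N
  k_inj : Set.InjOn k (Set.Iio n)
  l_mem : ∀ i < n, l i ∈ Set.Icc 1 N
  l_inj : Set.InjOn l (Set.Iio n)

/-- The array of values `exp (2 π i k_i (l_j - 1) / N)`. -/
noncomputable def shiftArray (N : ℕ) (k l : ℕ → ℕ) (i j : ℕ) : ℂ :=
  expFun (k i) (((l j : ℝ) - 1) / N)

namespace ShiftData

variable {N n : ℕ} {S Λ : ℕ → Set ℝ} {k l : ℕ → ℕ}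

theorem exists_freq (D : ShiftData N n S Λ k l) {i : ℕ} (hi : i < n) {x : ℝ}
    (hx : x ∈ translateSet (Λ i) (k i)) : ∃ z : ℤ, x = N * z + k i := by
  obtain ⟨y, hy, rfl⟩ := hx
  obtain ⟨z, rfl⟩ := D.freq i hi hy
  exact ⟨z, rfl⟩

theorem expFun_shift (D : ShiftData N n S Λ k l) {i : ℕ} (hi : i < n) {x : ℝ}
    (hx : x ∈ translateSet (Λ i) (k i)) (j : ℕ) (t : ℝ) :
    expFun x (t + ((l j : ℝ) - 1) / N) = shiftArray N k l i j * expFun x t := by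
  obtain ⟨z, rfl⟩ := D.exists_freq hi hx
  have hN : (N : ℝ) ≠ 0 := Nat.cast_ne_zero.2 D.pos.ne'
  rw [expFun_add_right, mul_comm, expFun_add_left _ _ (((l j : ℝ) - 1) / N),
    expFun_eq_one (l := N * z) (z * ((l j : ℤ) - 1)) (by push_cast; field_simp), one_mul, shiftArray]

theorem disjoint_freq (D : ShiftData N n S Λ k l) :
    Set.PairwiseDisjoint (Finset.range n : Set ℕ) fun i => translateSet (Λ i) (k i) := by
  intro i hi j hj hij
  rw [Function.onFun, Set.disjoint_left]
  intro x hx hx'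
  have hi' : i < n := by simpa using hi
  have hj' : j < n := by simpa using hj
  obtain ⟨z, hz⟩ := D.exists_freq hi' hx
  obtain ⟨w, hw⟩ := D.exists_freq hj' hx'
  have h1 : (N : ℤ) * z + k i = N * w + k j := by
    have := hz.symm.trans hw
    exact_mod_cast this
  have hki := D.k_mem i hi'
  have hkj := D.k_mem j hj'
  have h2 : ((k i - 1 : ℕ) : ℤ) % N = ((k j - 1 : ℕ) : ℤ) % N := by
    rw [← Int.add_mul_emod_self_left ((k i - 1 : ℕ) : ℤ) (N : ℤ) z,
      ← Int.add_mul_emod_self_left ((k j - 1 : ℕ) : ℤ) (N : ℤ) w]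
    congr 1
    push_cast [hki.1, hkj.1]
    linarith
  rw [Int.emod_eq_of_lt (by omega) (by have := hki.2; have := hki.1; omega),
    Int.emod_eq_of_lt (by omega) (by have := hkj.2; have := hkj.1; omega)] at h2
  refine hij (D.k_inj hi' hj' ?_)
  have := hki.1; have := hkj.1
  omega

theorem disjoint_sets (D : ShiftData N n S Λ k l) :
    Set.PairwiseDisjoint (Finset.range n : Set ℕ)
      fun j => translateSet (S j) (((l j : ℝ) - 1) / N) := by
  intro i hi j hj hij
  rw [Function.onFun, Set.disjoint_left]
  intro x hx hx'
  have hi' : i < n := by simpa using hi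
  have hj' : j < n := by simpa using hj
  have hN : (0 : ℝ) < N := Nat.cast_pos.2 D.pos
  obtain ⟨y, hy, rfl⟩ := hx
  obtain ⟨w, hw, hyw⟩ := hx'
  have h1 := D.subset_Ico i hi' hy
  have h2 := D.subset_Ico j hj' hw
  have e : (N : ℝ) * w + l j = N * y + l i := by
    simp only at hyw
    field_simp at hyw
    linarith
  have hy1 : (N : ℝ) * y < 1 := by have := (lt_div_iff₀ hN).1 h1.2; linarith
  have hw1 : (N : ℝ) * w < 1 := by have := (lt_div_iff₀ hN).1 h2.2; linarith
  have hy0 : (0 : ℝ) ≤ N * y := mul_nonneg hN.le h1.1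
  have hw0 : (0 : ℝ) ≤ N * w := mul_nonneg hN.le h2.1
  refine hij (D.l_inj hi' hj' ?_)
  have a1 : (l i : ℝ) < l j + 1 := by linarith
  have a2 : (l j : ℝ) < l i + 1 := by linarith
  have a1' : l i < l j + 1 := by exact_mod_cast a1
  have a2' : l j < l i + 1 := by exact_mod_cast a2
  omega

theorem iUnion_subset_Ico (D : ShiftData N n S Λ k l) :
    ⋃ j ∈ Finset.range n, translateSet (S j) (((l j : ℝ) - 1) / N)
      ⊆ Set.Ico (0 : ℝ) (1 / (1 : ℕ)) := by
  refine Set.iUnion₂_subset fun j hj => ?_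
  have hj' := Finset.mem_range.1 hj
  rintro _ ⟨y, hy, rfl⟩
  have hN : (0 : ℝ) < N := Nat.cast_pos.2 D.pos
  have h1 := D.subset_Ico j hj' hy
  have h2 : (1 : ℝ) ≤ l j := by exact_mod_cast (D.l_mem j hj').1
  have h3 : (l j : ℝ) ≤ N := by exact_mod_cast (D.l_mem j hj').2
  have hy1 : y * (N : ℝ) < 1 := (lt_div_iff₀ hN).1 h1.2
  refine ⟨add_nonneg h1.1 (div_nonneg (by linarith) hN.le), ?_⟩
  simp only [Nat.cast_one, div_one]
  rw [← mul_lt_mul_iff_left₀ hN, add_mul, div_mul_cancel₀ _ hN.ne']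
  linarith

/-- The upper Riesz inequality, from Parseval's identity on `[0, 1)`. -/
theorem lintegral_le (D : ShiftData N n S Λ k l) (s : Finset ℝ)
    (hs : (s : Set ℝ) ⊆ ⋃ i ∈ Finset.range n, translateSet (Λ i) (k i)) (c : ℝ → ℂ) :
    ∫⁻ t in ⋃ j ∈ Finset.range n, translateSet (S j) (((l j : ℝ) - 1) / N),
      ‖∑ x ∈ s, c x * expFun x t‖ₑ ^ 2 ≤ ∑ x ∈ s, ‖c x‖ₑ ^ 2 := by
  have hint : ∀ x ∈ s, ∃ z : ℤ, x = z := by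
    intro x hx
    obtain ⟨i, hi, hx⟩ := Set.mem_iUnion₂.1 (hs hx)
    obtain ⟨z, rfl⟩ := D.exists_freq (Finset.mem_range.1 hi) hx
    exact ⟨N * z + k i, by push_cast; rfl⟩
  rw [lintegral_sum_expFun one_pos s (fun x hx y hy => by
    obtain ⟨z, rfl⟩ := hint x hx
    obtain ⟨w, rfl⟩ := hint y hy
    exact ⟨z - w, by push_cast; ring⟩) c, Nat.cast_one, one_mul]
  simpa using lintegral_mono_set D.iUnion_subset_Ico

theorem exists_lowerBound (D : ShiftData N n S Λ k l)
    (hW : LeadingMinorsNeZero (shiftArray N k l) n)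
    (hlow : ∀ i < n, ∃ C, ExpLowerBound C (Λ i) (S i)) :
    ∃ C, ExpLowerBound C (⋃ i ∈ Finset.range n, translateSet (Λ i) (k i))
      (⋃ j ∈ Finset.range n, translateSet (S j) (((l j : ℝ) - 1) / N)) := by
  classical
  choose! C hC using hlow
  set K : NNReal := ∑ i ∈ Finset.range n, C i
  have hCK : ∀ i < n, C i ≤ K := fun i hi =>
    Finset.single_le_sum (f := C) (fun _ _ => zero_le) (Finset.mem_range.2 hi)
  set μ := volume.restrict (Set.Ico (0 : ℝ) (1 / N)) with hμ
  obtain ⟨B, hB⟩ := hW.exists_lintegral_le μ K D.anti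
  have hμS : ∀ i < n, μ.restrict (S i) = volume.restrict (S i) := fun i hi =>
    Measure.restrict_restrict_of_subset (D.subset_Ico i hi)
  refine ⟨N * B, fun s hs c => ?_⟩
  -- The frequencies of one residue class, and the corresponding partial sum `p i`.
  set σ : ℕ → Finset ℝ := fun i => s.filter (· ∈ translateSet (Λ i) (k i)) with hσ
  have hσmem : ∀ i, (σ i : Set ℝ) ⊆ translateSet (Λ i) (k i) := fun i x hx =>
    (Finset.mem_filter.1 (Finset.mem_coe.1 hx)).2
  have hsplit : ∀ {G : Type} [AddCommMonoid G] (F : ℝ → G),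
      ∑ x ∈ s, F x = ∑ i ∈ Finset.range n, ∑ x ∈ σ i, F x := by
    intro G _ F
    rw [← Finset.sum_biUnion]
    · refine Finset.sum_congr ?_ fun _ _ => rfl
      ext x
      rw [Finset.mem_biUnion]
      constructor
      · intro hx
        obtain ⟨i, hi, hxi⟩ := Set.mem_iUnion₂.1 (hs hx)
        exact ⟨i, hi, Finset.mem_filter.2 ⟨hx, hxi⟩⟩
      · rintro ⟨i, -, hx⟩
        exact (Finset.mem_filter.1 hx).1
    · intro i hi j hj hij
      rw [Function.onFun, Finset.disjoint_left]
      exact fun x hx hx' =>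
        Set.disjoint_left.1 (D.disjoint_freq hi hj hij) (hσmem i hx) (hσmem j hx')
  set p : ℕ → ℝ → ℂ := fun i t => ∑ x ∈ σ i, c x * expFun x t with hp
  have hparseval : ∀ i < n, ∑ x ∈ σ i, ‖c x‖ₑ ^ 2 = N * ∫⁻ t, ‖p i t‖ₑ ^ 2 ∂μ := fun i hi =>
    lintegral_sum_expFun D.pos (σ i) (fun x hx y hy => by
      obtain ⟨z, rfl⟩ := D.exists_freq hi (hσmem i hx)
      obtain ⟨w, rfl⟩ := D.exists_freq hi (hσmem i hy)
      exact ⟨z - w, by push_cast; ring⟩) c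
  have h1 := hB p (fun i _ => (continuous_finsetSum _ fun x _ =>
      continuous_const.mul (continuous_expFun x)).measurable) (fun i hi => by
    rw [hμS i hi]
    calc ∫⁻ t, ‖p i t‖ₑ ^ 2 ∂μ ≤ N * ∫⁻ t, ‖p i t‖ₑ ^ 2 ∂μ :=
          le_mul_of_one_le_left zero_le (by exact_mod_cast D.pos)
      _ = ∑ x ∈ σ i, ‖c x‖ₑ ^ 2 := (hparseval i hi).symm
      _ ≤ C i * ∫⁻ t in S i, ‖p i t‖ₑ ^ 2 := (hC i hi).translate (k i) (σ i) (hσmem i) c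
      _ ≤ K * ∫⁻ t in S i, ‖p i t‖ₑ ^ 2 := by gcongr; exact hCK i hi)
  rw [lintegral_iUnion_translateSet D.measurable D.disjoint_sets, hsplit,
    Finset.sum_congr rfl fun i hi => hparseval i (Finset.mem_range.1 hi), ← Finset.mul_sum,
    ENNReal.coe_mul, mul_assoc, ENNReal.coe_natCast]
  gcongr
  refine h1.trans_eq ?_
  congr 1
  refine Finset.sum_congr rfl fun j hj => ?_
  rw [hμS j (Finset.mem_range.1 hj)]
  refine lintegral_congr fun t => ?_
  rw [hsplit fun x => c x * expFun x (t + ((l j : ℝ) - 1) / N)]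
  congr 2
  refine Finset.sum_congr rfl fun i hi => ?_
  rw [hp, Finset.mul_sum]
  refine Finset.sum_congr rfl fun x hx => ?_
  rw [D.expFun_shift (Finset.mem_range.1 hi) (hσmem i hx)]
  ring

theorem total (D : ShiftData N n S Λ k l)
    (hW : LeadingMinorsNeZero (shiftArray N k l) n)
    (htot : ∀ i < n, ExpTotal (Λ i) (S i)) :
    ExpTotal (⋃ i ∈ Finset.range n, translateSet (Λ i) (k i))
      (⋃ j ∈ Finset.range n, translateSet (S j) (((l j : ℝ) - 1) / N)) := by
  intro v hv horth
  set a : ℕ → ℝ := fun j => ((l j : ℝ) - 1) / N with ha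
  set U := ⋃ j ∈ Finset.range n, translateSet (S j) (a j) with hU
  have hUfin : volume U ≠ ⊤ :=
    ((measure_mono D.iUnion_subset_Ico).trans_lt (by simp)).ne
  -- The pieces of `v`, moved to `[0, 1/N)` and extended by zero.
  set u : ℕ → ℝ → ℂ := fun j => (S j).indicator fun t => v (t + a j) with hu
  have hvj : ∀ j < n, MemLp (fun t => v (t + a j)) 2 (volume.restrict (S j)) := by
    intro j hj
    have h1 : MemLp v 2 (volume.restrict (translateSet (S j) (a j))) :=
      hv.mono_measure (Measure.restrict_mono_set _
        (Set.subset_biUnion_of_mem (u := fun j => translateSet (S j) (a j))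
          (Finset.mem_coe.2 (Finset.mem_range.2 hj))))
    exact h1.comp_measurePreserving (measurePreserving_restrict_translateSet _ _)
  have huj : ∀ j < n, MemLp (u j) 2 volume := fun j hj =>
    (memLp_indicator_iff_restrict (D.measurable j hj)).2 (hvj j hj)
  have hq2 : ∀ i, MemLp (fun t => ∑ j ∈ Finset.range n,
      (starRingEnd ℂ) (shiftArray N k l i j) * u j t) 2 volume := fun i =>
    memLp_finsetSum _ fun j hj => (huj j (Finset.mem_range.1 hj)).const_mul _
  have key : ∀ᵐ t : ℝ, ∀ j < n, u j t = 0 := by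
    refine hW.conj.ae_eq_zero D.anti (fun j _ t ht => Set.indicator_of_notMem ht _) ?_
    intro i hi hout
    set q : ℝ → ℂ := fun t => ∑ j ∈ Finset.range n,
      (starRingEnd ℂ) (shiftArray N k l i j) * u j t with hq
    have hzero : ∀ x ∈ translateSet (Λ i) (k i), ∫ t in S i, expFun (-x) t * q t = 0 := by
      intro x hx
      have e1 : ∫ t in S i, expFun (-x) t * q t = ∫ t, expFun (-x) t * q t := by
        rw [← integral_indicator (D.measurable i hi)]
        refine integral_congr_ae ?_
        filter_upwards [hout] with t ht
        by_cases hti : t ∈ S i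
        · rw [Set.indicator_of_mem hti]
        · rw [Set.indicator_of_notMem hti, hq]
          simp only
          rw [ht hti, mul_zero]
      have hfun : ∀ j ∈ Finset.range n, ∀ t,
          expFun (-x) t * ((starRingEnd ℂ) (shiftArray N k l i j) * u j t)
            = (S j).indicator (fun t => expFun (-x) (t + a j) * v (t + a j)) t := by
        intro j _ t
        by_cases htj : t ∈ S j
        · rw [hu]
          simp only [Set.indicator_of_mem htj]
          rw [← conj_expFun, ← conj_expFun, ha, D.expFun_shift hi hx, map_mul]
          ring
        · rw [hu]
          simp only [Set.indicator_of_notMem htj, mul_zero]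
      have hintU : IntegrableOn (fun t => expFun (-x) t * v t) U :=
        MemLp.integrable_mul (memLp_expFun (-x) hUfin) hv
      have hintj : ∀ j ∈ Finset.range n,
          IntegrableOn (fun t => expFun (-x) (t + a j) * v (t + a j)) (S j) := by
        intro j hj
        have h1 : IntegrableOn (fun t => expFun (-x) t * v t) (translateSet (S j) (a j)) :=
          hintU.mono_set (Set.subset_biUnion_of_mem (u := fun j => translateSet (S j) (a j)) hj)
        exact (measurePreserving_restrict_translateSet (S j) (a j)).integrable_comp_of_integrable h1
      rw [e1, ← horth x (Set.mem_biUnion (Finset.mem_coe.2 (Finset.mem_range.2 hi)) hx),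
        integral_iUnion_translateSet D.measurable D.disjoint_sets hintU]
      simp only [hq, Finset.mul_sum]
      rw [integral_congr_ae (Filter.Eventually.of_forall fun t =>
        Finset.sum_congr rfl fun j hj => hfun j hj t), integral_finsetSum]
      · refine Finset.sum_congr rfl fun j hj => ?_
        exact integral_indicator (D.measurable j (Finset.mem_range.1 hj))
      · intro j hj
        exact (integrable_indicator_iff (D.measurable j (Finset.mem_range.1 hj))).2 (hintj j hj)
    have h1 := (htot i hi).translate (k i) q ((hq2 i).restrict _) hzero
    have h2 := (ae_restrict_iff' (D.measurable i hi)).1 h1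
    filter_upwards [h2, hout] with t ht1 ht2
    by_cases hti : t ∈ S i
    exacts [ht1 hti, ht2 hti]
  refine ae_restrict_iUnion_translateSet fun j hj => ?_
  rw [ae_restrict_iff' (D.measurable j hj)]
  filter_upwards [key] with t ht htj
  exact (Set.indicator_of_mem htj fun t => v (t + a j)).symm.trans (ht j hj)

/-- The combined system is a Riesz basis as soon as the leading minors of the array of phases do
not vanish. -/
theorem expRieszBasis (D : ShiftData N n S Λ k l)
    (hW : LeadingMinorsNeZero (shiftArray N k l) n)
    (hRB : ∀ i < n, ExpRieszBasis (Λ i) (S i)) :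
    ExpRieszBasis (⋃ i ∈ Finset.range n, translateSet (Λ i) (k i))
      (⋃ j ∈ Finset.range n, translateSet (S j) (((l j : ℝ) - 1) / N)) := by
  obtain ⟨C, hC⟩ := D.exists_lowerBound hW fun i hi => (hRB i hi).exists_lowerBound
  exact expRieszBasis_of_bounds ((measure_mono D.iUnion_subset_Ico).trans_lt (by simp)).ne hC
    (D.total hW fun i hi => (hRB i hi).total) D.lintegral_le

end ShiftData

/-! ### Nonvanishing of the leading minors -/

theorem shiftArray_eq_pow {N : ℕ} (k l : ℕ → ℕ) (i : ℕ) {j : ℕ} (hl : 1 ≤ l j) :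
    shiftArray N k l i j = Complex.exp (2 * Real.pi * Complex.I / N) ^ (k i * (l j - 1)) := by
  rw [shiftArray, expFun, ← Complex.exp_nat_mul]
  congr 1
  push_cast [hl]
  ring

/-- For consecutive shifts `1, 2, …` the array of phases is of Vandermonde type. -/
theorem leadingMinorsNeZero_shiftArray_succ {N n : ℕ} {l : ℕ → ℕ}
    (hl : ∀ j < n, l j ∈ Set.Icc 1 N) (hinj : Set.InjOn l (Set.Iio n)) :
    LeadingMinorsNeZero (shiftArray N (fun i => i + 1) l) n := by
  intro r hr
  rcases Nat.eq_zero_or_pos r with rfl | hr0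
  · simp
  have hN : N ≠ 0 := by have := hl 0 (by omega); have := this.1.trans this.2; omega
  have hω := Complex.isPrimitiveRoot_exp N hN
  set ω := Complex.exp (2 * Real.pi * Complex.I / N)
  set z : Fin r → ℂ := fun j => ω ^ (l j - 1) with hz
  have hzinj : Function.Injective z := by
    intro a b hab
    have ha := hl a (by omega)
    have hb := hl b (by omega)
    have h1 := hω.pow_inj (by have := ha.1; have := ha.2; omega)
      (by have := hb.1; have := hb.2; omega) hab
    refine Fin.ext (hinj (by simp; omega) (by simp; omega) ?_)
    have := ha.1; have := hb.1; omega
  have hmat : (Matrix.of fun i j : Fin r => shiftArray N (fun i => i + 1) l i j)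
      = (Matrix.vandermonde z).transpose * Matrix.diagonal z := by
    ext i j
    rw [Matrix.of_apply, shiftArray_eq_pow _ _ _ (hl j (by omega)).1, Matrix.mul_diagonal,
      Matrix.transpose_apply, Matrix.vandermonde_apply, ← pow_succ, hz, ← pow_mul, mul_comm ((i : ℕ) + 1)]
  rw [hmat, Matrix.det_mul, Matrix.det_transpose, Matrix.det_diagonal]
  exact mul_ne_zero (Matrix.det_vandermonde_ne_zero_iff.2 hzinj)
    (Finset.prod_ne_zero_iff.2 fun j _ => pow_ne_zero _ (Complex.exp_ne_zero _))

theorem leadingMinorsNeZero_shiftArray_of_prime {N n : ℕ} (hN : N.Prime) {k l : ℕ → ℕ}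
    (hk : ∀ j < n, k j ∈ Set.Icc 1 N) (hkinj : Set.InjOn k (Set.Iio n))
    (hl : ∀ j < n, l j ∈ Set.Icc 1 N) (hlinj : Set.InjOn l (Set.Iio n)) :
    LeadingMinorsNeZero (shiftArray N k l) n := by
  intro r hr
  have hω := Complex.isPrimitiveRoot_exp N hN.ne_zero
  have h := det_pow_mul_ne_zero_of_prime hN hω (fun i : Fin r => k i) (fun j : Fin r => l j - 1)
    (by
      intro a b hab
      have ha := hk a (by omega)
      have hb := hk b (by omega)
      have h1 := (ZMod.natCast_eq_natCast_iff _ _ _).1 hab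
      rw [← Nat.sub_add_cancel ha.1, ← Nat.sub_add_cancel hb.1] at h1
      have h2 := Nat.ModEq.eq_of_lt_of_lt (Nat.ModEq.add_right_cancel' 1 h1)
        (by have := ha.1; have := ha.2; omega) (by have := hb.1; have := hb.2; omega)
      refine Fin.ext (hkinj (by simp; omega) (by simp; omega) ?_)
      have := ha.1; have := hb.1; omega)
    (by
      intro a b hab
      have ha := hl a (by omega)
      have hb := hl b (by omega)
      have h2 := Nat.ModEq.eq_of_lt_of_lt ((ZMod.natCast_eq_natCast_iff _ _ _).1 hab)
        (by have := ha.1; have := ha.2; omega) (by have := hb.1; have := hb.2; omega)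
      refine Fin.ext (hlinj (by simp; omega) (by simp; omega) ?_)
      have := ha.1; have := hb.1; omega)
  convert h using 2
  ext i j
  exact shiftArray_eq_pow _ _ _ (hl j (by omega)).1

/-! ### Families indexed by a subset of the indices -/

/-- The data attached to an increasing enumeration `σ` of a set of indices. -/
theorem shiftData_comp {M N n : ℕ} (hM : 1 ≤ M) (hMN : M ≤ N) {S Λ : ℕ → Set ℝ}
    (hSmeas : ∀ m ∈ Set.Icc 1 M, MeasurableSet (S m))
    (hSnest : ∀ m, 1 ≤ m → m + 1 ≤ M → S (m + 1) ⊆ S m)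
    (hS1 : S 1 ⊆ Set.Ico (0 : ℝ) (1 / (N : ℝ)))
    (hΛ : ∀ m ∈ Set.Icc 1 M, Λ m ⊆ Set.range (fun z : ℤ => (N : ℝ) * (z : ℝ)))
    {k l : ℕ → ℕ} (hk : Set.BijOn k (Set.Icc 1 N) (Set.Icc 1 N))
    (hl : Set.BijOn l (Set.Icc 1 N) (Set.Icc 1 N)) {σ : ℕ → ℕ}
    (hσ : StrictMonoOn σ (Set.Iio n)) (hσM : ∀ i < n, σ i ∈ Set.Icc 1 M) :
    ShiftData N n (fun i => S (σ i)) (fun i => Λ (σ i)) (fun i => k (σ i)) (fun i => l (σ i)) := by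
  have hσN : ∀ i < n, σ i ∈ Set.Icc 1 N := fun i hi =>
    ⟨(hσM i hi).1, (hσM i hi).2.trans hMN⟩
  have hanti : ∀ a b, 1 ≤ a → a ≤ b → b ≤ M → S b ⊆ S a := by
    intro a b ha hab
    induction b, hab using Nat.le_induction with
    | base => exact fun _ => subset_rfl
    | succ b hab ih => exact fun hb => (hSnest b (ha.trans hab) hb).trans (ih (by omega))
  exact
    { pos := by omega
      measurable := fun i hi => hSmeas _ (hσM i hi)
      anti := fun i j hij hj => hanti _ _ (hσM i (hij.trans_lt hj)).1
        (hσ.monotoneOn (hij.trans_lt hj) hj hij) (hσM j hj).2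
      subset_Ico := fun i hi => (hanti 1 _ le_rfl (hσM i hi).1 (hσM i hi).2).trans hS1
      freq := fun i hi => hΛ _ (hσM i hi)
      k_mem := fun i hi => hk.mapsTo (hσN i hi)
      k_inj := fun i hi j hj h => hσ.injOn hi hj (hk.injOn (hσN i hi) (hσN j hj) h)
      l_mem := fun i hi => hl.mapsTo (hσN i hi)
      l_inj := fun i hi j hj h => hσ.injOn hi hj (hl.injOn (hσN i hi) (hσN j hj) h) }

theorem biUnion_eq_of_image {J : Set ℕ} {σ : ℕ → ℕ} {n : ℕ} (h : σ '' Set.Iio n = J)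
    (F : ℕ → Set ℝ) : ⋃ m ∈ J, F m = ⋃ i ∈ Finset.range n, F (σ i) := by
  rw [← h, Set.biUnion_image]
  simp

theorem proposition3p3 (M N : ℕ) (hM : 1 ≤ M) (hMN : M ≤ N)
    (S Λ : ℕ → Set ℝ)
    (hSmeas : ∀ m ∈ Set.Icc 1 M, MeasurableSet (S m))
    (hSnest : ∀ m, 1 ≤ m → m + 1 ≤ M → S (m + 1) ⊆ S m)
    (hS1 : S 1 ⊆ Set.Ico (0 : ℝ) (1 / (N : ℝ)))
    (hΛ : ∀ m ∈ Set.Icc 1 M, Λ m ⊆ Set.range (fun z : ℤ => (N : ℝ) * (z : ℝ)))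
    (hRB : ∀ m ∈ Set.Icc 1 M, ExpRieszBasis (Λ m) (S m)) :
    (∀ ℓ : ℕ → ℕ, Set.BijOn ℓ (Set.Icc 1 N) (Set.Icc 1 N) →
      ExpRieszBasis
        (⋃ m ∈ Set.Icc 1 M, translateSet (Λ m) (m : ℝ))
        (⋃ m ∈ Set.Icc 1 M, translateSet (S m) (((ℓ m : ℝ) - 1) / (N : ℝ)))) ∧
    (N.Prime →
      ∀ k ℓ : ℕ → ℕ, Set.BijOn k (Set.Icc 1 N) (Set.Icc 1 N) →
        Set.BijOn ℓ (Set.Icc 1 N) (Set.Icc 1 N) →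
        ExpRieszBasis
          (⋃ m ∈ Set.Icc 1 M, translateSet (Λ m) (k m : ℝ))
          (⋃ m ∈ Set.Icc 1 M, translateSet (S m) (((ℓ m : ℝ) - 1) / (N : ℝ))) ∧
        ∀ J ⊆ Set.Icc 1 M,
          ExpRieszBasis
            (⋃ m ∈ J, translateSet (Λ m) (k m : ℝ))
            (⋃ m ∈ J, translateSet (S m) (((ℓ m : ℝ) - 1) / (N : ℝ)))) := by
  constructor
  · intro ℓ hℓ
    have hσ : StrictMonoOn (fun i : ℕ => i + 1) (Set.Iio M) := fun i _ j _ hij => by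
      simpa using hij
    have hσM : ∀ i < M, i + 1 ∈ Set.Icc 1 M := fun i hi => ⟨by omega, hi⟩
    have himg : (fun i : ℕ => i + 1) '' Set.Iio M = Set.Icc 1 M := by
      ext m
      constructor
      · rintro ⟨i, hi, rfl⟩
        exact hσM i hi
      · intro hm
        exact ⟨m - 1, by have := hm.1; have := hm.2; simp; omega, Nat.sub_add_cancel hm.1⟩
    have D := shiftData_comp hM hMN hSmeas hSnest hS1 hΛ (k := fun i => i)
      (Set.bijOn_id _) hℓ hσ hσM
    rw [biUnion_eq_of_image himg, biUnion_eq_of_image himg]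
    exact D.expRieszBasis (leadingMinorsNeZero_shiftArray_succ D.l_mem D.l_inj)
      fun i hi => hRB _ (hσM i hi)
  · intro hN k ℓ hk hℓ
    have hJ : ∀ J ⊆ Set.Icc 1 M,
        ExpRieszBasis (⋃ m ∈ J, translateSet (Λ m) (k m : ℝ))
          (⋃ m ∈ J, translateSet (S m) (((ℓ m : ℝ) - 1) / (N : ℝ))) := by
      intro J hJM
      -- `Nat.nth` enumerates the finite set `J` increasingly.
      have hf : (Set.ofPred fun m => m ∈ J).Finite := (Set.finite_Icc 1 M).subset hJM
      have himg : Nat.nth (fun m => m ∈ J) '' Set.Iio hf.toFinset.card = J :=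
        Nat.image_nth_Iio_card hf
      have hσM : ∀ i < hf.toFinset.card, Nat.nth (fun m => m ∈ J) i ∈ Set.Icc 1 M :=
        fun i hi => hJM (Nat.nth_mem_of_lt_card hf hi)
      have D := shiftData_comp hM hMN hSmeas hSnest hS1 hΛ hk hℓ (Nat.nth_strictMonoOn hf) hσM
      rw [biUnion_eq_of_image himg, biUnion_eq_of_image himg]
      exact D.expRieszBasis
        (leadingMinorsNeZero_shiftArray_of_prime hN D.k_mem D.k_inj D.l_mem D.l_inj)
        fun i hi => hRB _ (hσM i hi)
    exact ⟨hJ _ subset_rfl, hJ⟩
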